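/- Consider $N$ agents with positions $p^i\in\mathbb R^n$ and velocities $v^i\in\mathbb R^n$, $i=1,\dots,N$, and finitely many static obstacles, with disturbance-free Lagrangian dynamics $$\dot p^i=v^i,\qquad M^i(p^i)\dot v^i+C^i(p^i,v^i)v^i+G^i(p^i)+D^i(p^i,v^i)=\tau^i,$$ where $M^i(p)$ is differentiable in $p$, symmetric and positive definite, and $\dot M^i-2C^i$ is skew-symmetric ($\dot M^i$ being the derivative of $M^i$ along $\dot p^i=v^i$). **Safety functions.** Let $\Xi$ be a symmetric positive definite matrix, $\|z\|_\Xi=\sqrt{z^\top\Xi z}$, and let $r_s,\Delta r_s\ge 0$ and $r_{\rm sen}>r_s+\Delta r_s$ be such that $\|z\|_\Xi\le r_{\rm sen}$ whenever $\|z\|\le r_{\rm sen}$, and such that every $z$ with $\|z\|_\Xi\le r_s+\Delta r_s$ satisfies $\|z\|<r_{\rm sen}$ (the collision region lies within sensing range). Put $$h(z)=\frac{\|z\|_\Xi-(r_s+\Delta r_s)}{r_{\rm sen}-(r_s+\Delta r_s)},\qquad p^{ij}=p^j-p^i .$$ A configuration is called *collision-free* if $h(p^{ij})>0$ for every agent $i$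 and every other object $j$ (agent or obstacle). For agent $i$ let $\mathcal S^i$ be the set of all other objects $j$ with $\|p^{ij}\|\le r_{\rm sen}$, and let $H^i=\prod_{j\in\mathcal S^i}h(p^{ij})$, $\psi^i=-\log H^i$; $\nabla_{p^i}\psi^i$ is the gradient with respect to $p^i$ with the set $\mathcal S^i$ and the positions of its members held fixed. Let $\alpha$ be a class $\mathcal K$ function on $[0,a]$, $a\ge 1$ (continuous, strictly increasing, $\alpha(0)=0$), with $$\alpha(s)\le\frac{N-1}{-\log s+(N-1)},\qquad s\in(0,1].$$ **Filter.** Let $v_s^i=\alpha(H^i)\|\nabla_{p^i}\psi^i\|^{-2}\nabla_{p^i}\psi^i$ (and $v_s^i=0$ if $\nabla_{p^i}\psi^i=0$), $e_v^i=v^i-v_s^i$ and, for constants $k_p,k_v>0$, $$\bar\tau_s^i=M^i\dot v_s^i+C^iv_s^i+G^i+D^i-k_p\nabla_{p^i}\psi^i-k_vM^ie_v^i .$$ Given a learned control policy $\tau_\ell^i$ (an arbitrary function of time and of the positions and velocities), let $$\tau_s^i=\tau_\ell^i-\begin{cases}\dfrac{(\tau_\ell^i-\bar\tau_s^i)^\top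 e_v^i}{\|e_v^i\|^2}\,e_v^i&\text{if }(\tau_\ell^i-\bar\tau_s^i)^\top e_v^i>0,\\[1ex]0&\text{otherwise.}\end{cases}$$ **Motions.** A motion on $[0,T)$ consists of continuous $p^i,v^i$ such that, at all times $t\in(0,T)$ outside some exceptional set of times which is finite on each $[0,t']$, $t'<T$, and at which the configuration is collision-free, the sets $\mathcal S^i$ are locally constant in time, the $v_s^i$ are differentiable in time, and the dynamics hold. **Theorem.** 1. If a motion on $[0,T)$ starts at a collision-free configuration and its inputs satisfy $(\tau^i-\bar\tau_s^i)^\top e_v^i\le 0$ for all $i$ at all the non-exceptional times at which the configuration is collision-free, then its configuration is collision-free at every $t\in[0,T)$. 2. In particular the same holds for every motion whose inputs are $\tau^i=\tau_s^i$ at those times. 3. For every $i$, every time, every state and every value of $\dot v_s^i$, the problem $$\min_{\tau^i\in\mathbb R^n}\|\tau^i-\tau_\ell^i\|^2\quad\text{subject to}\quad(\tau^i-\bar\tau_s^i)^\top e_v^i\le 0$$ is feasible and $\tau_s^i$ is its unique optimal solution. -/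

import Mathlib

open Set Filter Topology
open scoped BigOperators InnerProductSpace

noncomputable section

namespace SafetyFilter

/-- The Euclidean space `ℝⁿ` in which positions, velocities and inputs live. -/
abbrev E (n : ℕ) := EuclideanSpace ℝ (Fin n)

/-- A symmetric positive definite `n × n` matrix, viewed as an operator on `ℝⁿ`. -/
def IsPosDef {n : ℕ} (A : E n →L[ℝ] E n) : Prop :=
  IsSelfAdjoint A ∧ ∀ z : E n, z ≠ 0 → 0 < ⟪z, A z⟫_ℝ

/-- The weighted norm `‖z‖_Ξ = √(zᵀ Ξ z)`. -/
def weightedNorm {n : ℕ} (Xi : E n →L[ℝ] E n) (z : E n) : ℝ :=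
  Real.sqrt ⟪z, Xi z⟫_ℝ

/-- The safety parameters: the weight `Ξ ≻ 0`, the minimal safe distance `r_s`, the margin `Δr_s`
and the sensing radius `r_sen`. -/
structure SafetyParams (n : ℕ) where
  Xi : E n →L[ℝ] E n
  rs : ℝ
  drs : ℝ
  rsen : ℝ
  posDef_Xi : IsPosDef Xi
  rs_nonneg : 0 ≤ rs
  drs_nonneg : 0 ≤ drs
  margin : 0 < rsen - (rs + drs)
  /-- `sup_{‖z‖ ≤ r_sen} ‖z‖_Ξ ≤ r_sen` -/
  weightedNorm_le : ∀ z : E n, ‖z‖ ≤ rsen → weightedNorm Xi z ≤ rsen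
  /-- the collision ellipsoid lies within sensing range -/
  collision_sensed : ∀ z : E n, weightedNorm Xi z ≤ rs + drs → ‖z‖ < rsen

/-- The pairwise safety function
`h(z) = (‖z‖_Ξ - (r_s + Δr_s)) / (r_sen - (r_s + Δr_s))`. -/
def SafetyParams.h {n : ℕ} (P : SafetyParams n) (z : E n) : ℝ :=
  (weightedNorm P.Xi z - (P.rs + P.drs)) / (P.rsen - (P.rs + P.drs))

/-- The matrices and vectors of the Lagrangian dynamics
`M(p) v' + C(p, v) v + G(p) + D(p, v) = τ` of one agent, with `M` symmetric positive definite and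
`M' - 2 C` skew-symmetric, where `M'` is the derivative of `M` along `p' = v`. -/
structure LagrangianAgent (n : ℕ) where
  M : E n → E n →L[ℝ] E n
  C : E n → E n → E n →L[ℝ] E n
  G : E n → E n
  D : E n → E n → E n
  differentiable_M : Differentiable ℝ M
  posDef_M : ∀ p, IsPosDef (M p)
  skew : ∀ p v, fderiv ℝ M p v - (2 : ℝ) • C p v ∈ skewAdjoint (E n →L[ℝ] E n)

/-- A class `K` function on `[0, a]`. -/
structure IsClassK (a : ℝ) (α : ℝ → ℝ) : Prop where
  continuousOn : ContinuousOn α (Icc 0 a)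
  strictMonoOn : StrictMonoOn α (Icc 0 a)
  map_zero : α 0 = 0

section Configuration

variable {n N : ℕ} {κ : Type*}

/-- The position of an object: an agent `Sum.inl j` at `X j` or a static obstacle `Sum.inr k` at
`obs k`. -/
def objPos (obs : κ → E n) (X : Fin N → E n) : Fin N ⊕ κ → E n :=
  Sum.elim X obs

/-- No agent is in collision with any other object: `h(p^{ij}) > 0` for every agent `i` and every
other object `j`. -/
def CollisionFree (P : SafetyParams n) (obs : κ → E n) (X : Fin N → E n) : Prop :=
  ∀ i : Fin N, ∀ j : Fin N ⊕ κ, j ≠ Sum.inl i → 0 < P.h (objPos obs X j - X i)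

variable [Fintype κ]

open Classical in
/-- The set `S^i` of the neighboring objects of agent `i`: the objects other than `i` within the
sensing radius. -/
def neighbors (P : SafetyParams n) (obs : κ → E n) (X : Fin N → E n) (i : Fin N) :
    Finset (Fin N ⊕ κ) :=
  Finset.univ.filter fun j => j ≠ Sum.inl i ∧ ‖objPos obs X j - X i‖ ≤ P.rsen

/-- `H^i = ∏_{j ∈ S^i} h(p^{ij})`. -/
def localH (P : SafetyParams n) (obs : κ → E n) (X : Fin N → E n) (i : Fin N) : ℝ :=
  ∏ j ∈ neighbors P obs X i, P.h (objPos obs X j - X i)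

/-- `∇_{p^i} ψ^i` for `ψ^i = -log ∏_{j ∈ S^i} h(p^j - p^i)`: the gradient with respect to the
position of agent `i`, for the current neighbors at their current positions. -/
def gradPsi (P : SafetyParams n) (obs : κ → E n) (X : Fin N → E n) (i : Fin N) : E n :=
  gradient (fun q : E n => -Real.log (∏ j ∈ neighbors P obs X i, P.h (objPos obs X j - q))) (X i)

/-- The safe velocity `v_s^i = α(H^i) ‖∇ψ^i‖⁻² ∇ψ^i`; it is `0` where `∇ψ^i = 0`, in particular
where agent `i` has no neighbors. -/
def safeVel (P : SafetyParams n) (obs : κ → E n) (α : ℝ → ℝ) (X : Fin N → E n) (i : Fin N) : E n :=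
  (α (localH P obs X i) * (‖gradPsi P obs X i‖ ^ 2)⁻¹) • gradPsi P obs X i

/-- The velocity error `e_v^i = v^i - v_s^i`. -/
def velErr (P : SafetyParams n) (obs : κ → E n) (α : ℝ → ℝ) (X V : Fin N → E n) (i : Fin N) :
    E n :=
  V i - safeVel P obs α X i

/-- `τ̄_s^i = M^i w + C^i v_s^i + G^i + D^i - k_p ∇ψ^i - k_v M^i e_v^i`, where `w` stands for the
time derivative of `v_s^i`. -/
def tauBar (P : SafetyParams n) (obs : κ → E n) (L : Fin N → LagrangianAgent n) (α : ℝ → ℝ)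
    (kp kv : ℝ) (X V : Fin N → E n) (i : Fin N) (w : E n) : E n :=
  (L i).M (X i) w + (L i).C (X i) (V i) (safeVel P obs α X i) + (L i).G (X i)
    + (L i).D (X i) (V i) - kp • gradPsi P obs X i
    - kv • (L i).M (X i) (velErr P obs α X V i)

/-- A motion on `[0, T)` of the disturbance-free system under the input signal `u`, with `Z` a
locally finite set of exceptional times. Off `Z`, and as long as the configuration is
collision-free (so that the safety functions are defined), the sets of neighbors are locally
constant in time, the safe velocities are differentiable in time, and the equations
`p' = v`, `M v' + C v + G + D = u` hold. -/
structure IsMotion (P : SafetyParams n) (obs : κ → E n) (L : Fin N → LagrangianAgent n)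
    (α : ℝ → ℝ) (T : ℝ) (Z : Set ℝ) (u p v : ℝ → Fin N → E n) : Prop where
  locallyFinite : ∀ t < T, (Z ∩ Icc 0 t).Finite
  continuousOn_p : ContinuousOn p (Ico 0 T)
  continuousOn_v : ContinuousOn v (Ico 0 T)
  neighbors_const : ∀ t ∈ Ioo 0 T \ Z, CollisionFree P obs (p t) → ∀ i,
    ∀ᶠ s in 𝓝 t, neighbors P obs (p s) i = neighbors P obs (p t) i
  safeVel_diff : ∀ t ∈ Ioo 0 T \ Z, CollisionFree P obs (p t) → ∀ i,
    DifferentiableAt ℝ (fun s => safeVel P obs α (p s) i) t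
  kinematics : ∀ t ∈ Ioo 0 T \ Z, CollisionFree P obs (p t) → ∀ i,
    HasDerivAt (fun s => p s i) (v t i) t
  dynamics : ∀ t ∈ Ioo 0 T \ Z, CollisionFree P obs (p t) → ∀ i, ∃ acc : E n,
    HasDerivAt (fun s => v s i) acc t ∧
      (L i).M (p t i) acc + (L i).C (p t i) (v t i) (v t i) + (L i).G (p t i)
        + (L i).D (p t i) (v t i) = u t i

end Configuration

/-- The feasible half-space `{τ | (τ - τ̄)ᵀ e ≤ 0}` of the safety filter. -/
def feasible {n : ℕ} (tb e : E n) : Set (E n) :=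
  {τ | ⟪τ - tb, e⟫_ℝ ≤ 0}

open Classical in
/-- The filtered input: `τ_ℓ - ((τ_ℓ - τ̄)ᵀ e / ‖e‖²) e` if `(τ_ℓ - τ̄)ᵀ e > 0`, and `τ_ℓ`
otherwise. -/
def filteredInput {n : ℕ} (tl tb e : E n) : E n :=
  tl - if 0 < ⟪tl - tb, e⟫_ℝ then (⟪tl - tb, e⟫_ℝ / ‖e‖ ^ 2) • e else 0

end SafetyFilter

end

open Set Filter Topology
open scoped BigOperators InnerProductSpace

noncomputable section

namespace SafetyFilter

/-! ### The filtered input as a projection -/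

section Projection

variable {n : ℕ}

/-! The energy is `k_p` times the sum of the barriers `-log h` over the sensed pairs, plus the
kinetic energy of the velocity errors. At regular times the constraint on the input bounds its
derivative by `k_p N α(1)` (`IsMotion.exists_hasDerivAt_energy_le`): skew-symmetry cancels the
Coriolis terms, and the `k_p` term of `τ̄` cancels the part of the barrier growth due to the
velocity errors. At a first collision time the colliding pair lies strictly within sensing range.
Just before it there are no exceptional times, so the energy, hence that pair's barrier, stays
bounded and `h` cannot tend to a nonpositive value. Jumps of the energy at exceptional times are
harmless: only the last regular interval matters. The filter is the metric projection onto a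
half-space, hence the unique minimizer. -/

theorem filteredInput_mem_feasible (tl tb e : E n) : filteredInput tl tb e ∈ feasible tb e := by
  unfold filteredInput feasible
  rw [mem_ofPred_eq]
  split_ifs with hd
  · have he : e ≠ 0 := by
      rintro rfl
      simp at hd
    have hn : ‖e‖ ^ 2 ≠ 0 := by simpa using he
    rw [sub_right_comm, inner_sub_left, real_inner_smul_left, real_inner_self_eq_norm_sq,
      div_mul_cancel₀ _ hn, sub_self]
  · simpa using hd

/-- The angle at the projection is not acute. The extra square on the left makes one inequality
yield both optimality and uniqueness. -/
theorem norm_sq_filteredInput_add_le {tl tb e τ : E n} (hτ : τ ∈ feasible tb e) :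
    ‖τ - filteredInput tl tb e‖ ^ 2 + ‖filteredInput tl tb e - tl‖ ^ 2 ≤ ‖τ - tl‖ ^ 2 := by
  have hkey : 0 ≤ ⟪τ - filteredInput tl tb e, filteredInput tl tb e - tl⟫_ℝ := by
    unfold filteredInput
    split_ifs with hd
    · have he : e ≠ 0 := by
        rintro rfl
        simp at hd
      have hn : ‖e‖ ^ 2 ≠ 0 := by simpa using he
      set d := ⟪tl - tb, e⟫_ℝ
      have h1 : tl - (d / ‖e‖ ^ 2) • e - tl = -((d / ‖e‖ ^ 2) • e) := by abel
      have h2 : τ - (tl - (d / ‖e‖ ^ 2) • e) = (τ - tb) - (tl - tb) + (d / ‖e‖ ^ 2) • e := by abel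
      rw [h1, h2, inner_neg_right, real_inner_smul_right, inner_add_left, inner_sub_left,
        real_inner_smul_left, real_inner_self_eq_norm_sq, div_mul_cancel₀ _ hn]
      have hτ' : ⟪τ - tb, e⟫_ℝ ≤ 0 := hτ
      have h3 : 0 ≤ d / ‖e‖ ^ 2 := by positivity
      have : ⟪τ - tb, e⟫_ℝ - d + d ≤ 0 := by linarith
      nlinarith
    · simp
  have hsplit : τ - tl = (τ - filteredInput tl tb e) + (filteredInput tl tb e - tl) := by abel
  rw [hsplit, norm_add_sq_real]
  linarith

end Projection

/-! ### The weighted norm, the safety function and its logarithmic barrier -/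

section Barrier

variable {n : ℕ}

theorem weightedNorm_neg (A : E n →L[ℝ] E n) (z : E n) :
    weightedNorm A (-z) = weightedNorm A z := by
  simp [weightedNorm]

theorem continuous_weightedNorm (A : E n →L[ℝ] E n) : Continuous (weightedNorm A) := by
  unfold weightedNorm
  fun_prop

theorem differentiableAt_weightedNorm {A : E n →L[ℝ] E n} {z : E n} (hz : 0 < weightedNorm A z) :
    DifferentiableAt ℝ (weightedNorm A) z := by
  have h0 : ⟪z, A z⟫_ℝ ≠ 0 := (Real.sqrt_pos.1 hz).ne'
  have h1 : DifferentiableAt ℝ (fun z : E n => ⟪z, A z⟫_ℝ) z :=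
    differentiableAt_id.inner ℝ A.differentiableAt
  exact h1.sqrt h0

namespace SafetyParams

variable (P : SafetyParams n)

theorem h_neg (z : E n) : P.h (-z) = P.h z := by
  simp [h, weightedNorm_neg]

theorem continuous_h : Continuous P.h := by
  unfold h
  exact ((continuous_weightedNorm P.Xi).sub continuous_const).div_const _

theorem h_pos_iff {z : E n} : 0 < P.h z ↔ P.rs + P.drs < weightedNorm P.Xi z := by
  unfold h
  rw [div_pos_iff_of_pos_right P.margin, sub_pos]

theorem norm_lt_of_h_nonpos {z : E n} (hz : P.h z ≤ 0) : ‖z‖ < P.rsen :=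
  P.collision_sensed z (not_lt.1 fun hlt => not_lt.2 hz (P.h_pos_iff.2 hlt))

theorem h_le_one {z : E n} (hz : ‖z‖ ≤ P.rsen) : P.h z ≤ 1 := by
  unfold h
  rw [div_le_one P.margin]
  linarith [P.weightedNorm_le z hz]

theorem differentiableAt_h {z : E n} (hz : 0 < P.h z) : DifferentiableAt ℝ P.h z := by
  have hw : 0 < weightedNorm P.Xi z :=
    (add_nonneg P.rs_nonneg P.drs_nonneg).trans_lt (P.h_pos_iff.1 hz)
  exact ((differentiableAt_weightedNorm hw).sub_const (P.rs + P.drs)).mul_const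
    (P.rsen - (P.rs + P.drs))⁻¹

/-- The logarithmic barrier `-log h(z)` of a pair of objects in relative position `z`. -/
def barrier (z : E n) : ℝ :=
  -Real.log (P.h z)

theorem differentiableAt_barrier {z : E n} (hz : 0 < P.h z) :
    DifferentiableAt ℝ P.barrier z :=
  ((P.differentiableAt_h hz).log hz.ne').neg

theorem barrier_nonneg {z : E n} (hz : 0 < P.h z) (hzs : ‖z‖ ≤ P.rsen) : 0 ≤ P.barrier z :=
  neg_nonneg.2 (Real.log_nonpos hz.le (P.h_le_one hzs))

/-- The barrier is even, so its derivative is odd: the two agents of a pair feel opposite forces. -/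
theorem fderiv_barrier_neg (z : E n) : fderiv ℝ P.barrier (-z) = -fderiv ℝ P.barrier z := by
  have heven : (fun z => P.barrier (-z)) = P.barrier := by
    funext z
    simp [barrier, h_neg]
  have hsmul := fderiv_comp_smul (𝕜 := ℝ) (f := P.barrier) (x := z) (-1)
  simp only [neg_one_smul, heven] at hsmul
  rw [hsmul, neg_neg]

end SafetyParams

end Barrier

/-! ### Configurations -/

section Configurations

variable {n N : ℕ} {κ : Type*} [Fintype κ]
  {P : SafetyParams n} {obs : κ → E n} {X : Fin N → E n}

theorem mem_neighbors {i : Fin N} {j : Fin N ⊕ κ} :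
    j ∈ neighbors P obs X i ↔ j ≠ Sum.inl i ∧ ‖objPos obs X j - X i‖ ≤ P.rsen := by
  simp [neighbors]

theorem inl_mem_neighbors_comm {i j : Fin N} :
    Sum.inl j ∈ neighbors P obs X i ↔ Sum.inl i ∈ neighbors P obs X j := by
  simp only [mem_neighbors, objPos, Sum.elim_inl, ne_eq, Sum.inl.injEq]
  rw [norm_sub_rev, eq_comm]

omit [Fintype κ] in
theorem continuous_objPos (obs : κ → E n) (j : Fin N ⊕ κ) :
    Continuous fun X : Fin N → E n => objPos obs X j := by
  cases j with
  | inl j => exact continuous_apply j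
  | inr k => exact continuous_const

theorem isOpen_collisionFree (P : SafetyParams n) (obs : κ → E n) :
    IsOpen {X : Fin N → E n | CollisionFree P obs X} := by
  simp only [CollisionFree, ofPred_forall]
  refine isOpen_iInter_of_finite fun i => isOpen_iInter_of_finite fun j =>
    isOpen_iInter_of_finite fun _ => ?_
  exact isOpen_lt continuous_const
    (P.continuous_h.comp ((continuous_objPos obs j).sub (continuous_apply i)))

theorem CollisionFree.h_pos (hX : CollisionFree P obs X) {i : Fin N} {j : Fin N ⊕ κ}
    (hj : j ∈ neighbors P obs X i) : 0 < P.h (objPos obs X j - X i) :=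
  hX i j (mem_neighbors.1 hj).1

theorem CollisionFree.localH_mem_Ioc (hX : CollisionFree P obs X) (i : Fin N) :
    localH P obs X i ∈ Ioc (0 : ℝ) 1 :=
  ⟨Finset.prod_pos fun _ hj => hX.h_pos hj,
    Finset.prod_le_one (fun _ hj => (hX.h_pos hj).le)
      fun _ hj => P.h_le_one (mem_neighbors.1 hj).2⟩

/-- The logarithm of the product splits only where all factors are nonzero, which holds near `X i`
by continuity. The sign comes from differentiating `q ↦ p^j - q`. -/
theorem CollisionFree.inner_gradPsi (hX : CollisionFree P obs X) (i : Fin N) (w : E n) :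
    ⟪gradPsi P obs X i, w⟫_ℝ =
      -∑ j ∈ neighbors P obs X i, fderiv ℝ P.barrier (objPos obs X j - X i) w := by
  have hlog : (fun q : E n => -Real.log (∏ j ∈ neighbors P obs X i, P.h (objPos obs X j - q)))
      =ᶠ[𝓝 (X i)] fun q => ∑ j ∈ neighbors P obs X i, P.barrier (objPos obs X j - q) := by
    have hpos : ∀ᶠ q in 𝓝 (X i), ∀ j ∈ neighbors P obs X i, 0 < P.h (objPos obs X j - q) := by
      rw [Filter.eventually_all_finset]
      intro j hj
      have hc : Continuous fun q => P.h (objPos obs X j - q) :=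
        P.continuous_h.comp (continuous_const.sub continuous_id)
      exact hc.continuousAt.eventually (lt_mem_nhds (hX.h_pos hj))
    filter_upwards [hpos] with q hq
    rw [Real.log_prod fun j hj => (hq j hj).ne']
    simp [SafetyParams.barrier]
  have hder : HasFDerivAt
      (fun q => ∑ j ∈ neighbors P obs X i, P.barrier (objPos obs X j - q))
      (∑ j ∈ neighbors P obs X i, -fderiv ℝ P.barrier (objPos obs X j - X i)) (X i) := by
    refine HasFDerivAt.fun_sum fun j hj => ?_
    have h1 := (P.differentiableAt_barrier (hX.h_pos hj)).hasFDerivAt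
    have h2 : HasFDerivAt (fun q : E n => objPos obs X j - q)
        (-ContinuousLinearMap.id ℝ (E n)) (X i) := (hasFDerivAt_id (X i)).const_sub _
    have h3 := h1.comp (X i) h2
    rw [ContinuousLinearMap.comp_neg, ContinuousLinearMap.comp_id] at h3
    exact h3
  unfold gradPsi gradient
  rw [InnerProductSpace.toDual_symm_apply, (hder.congr_of_eventuallyEq hlog).fderiv]
  simp

/-- The normalization of the safe velocity makes the left side `α(H)`, or `0` if the gradient
vanishes; monotonicity of `α` on `[0, 1]` covers both cases. -/
theorem CollisionFree.inner_gradPsi_safeVel_le (hX : CollisionFree P obs X) {a : ℝ} (ha : 1 ≤ a)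
    {α : ℝ → ℝ} (hα : IsClassK a α) (i : Fin N) :
    ⟪gradPsi P obs X i, safeVel P obs α X i⟫_ℝ ≤ α 1 := by
  have hH := hX.localH_mem_Ioc i
  have hmono := hα.strictMonoOn.monotoneOn
  have h1 : (1 : ℝ) ∈ Icc 0 a := ⟨zero_le_one, ha⟩
  have h0 : (0 : ℝ) ∈ Icc 0 a := ⟨le_rfl, zero_le_one.trans ha⟩
  rw [safeVel, real_inner_smul_right, real_inner_self_eq_norm_sq]
  by_cases hg : ‖gradPsi P obs X i‖ ^ 2 = 0
  · rw [hg, mul_zero, ← hα.map_zero]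
    exact hmono h0 h1 zero_le_one
  · rw [mul_assoc, inv_mul_cancel₀ hg, mul_one]
    exact hmono ⟨hH.1.le, hH.2.trans ha⟩ h1 hH.2

/-! ### The potential energy of a configuration -/

/-- The share of a pair's barrier attributed to one agent: pairs of agents are counted twice. -/
def pairWeight : Fin N ⊕ κ → ℝ :=
  Sum.elim (fun _ => 1 / 2) (fun _ => 1)

omit [Fintype κ] in
theorem half_le_pairWeight (j : Fin N ⊕ κ) : 1 / 2 ≤ pairWeight j := by
  cases j <;> norm_num [pairWeight]

/-- The sum of the barriers of all pairs of objects in sensing range, each pair counted once. -/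
def potential (P : SafetyParams n) (obs : κ → E n) (X : Fin N → E n) : ℝ :=
  ∑ i, ∑ j ∈ neighbors P obs X i, pairWeight j * P.barrier (objPos obs X j - X i)

/-- Within sensing range `h ≤ 1`, so no term of the potential is negative; the factor 2 undoes the
smallest pair weight `1/2`. -/
theorem CollisionFree.barrier_le_potential (hX : CollisionFree P obs X) {i : Fin N}
    {j : Fin N ⊕ κ} (hj : j ∈ neighbors P obs X i) :
    P.barrier (objPos obs X j - X i) ≤ 2 * potential P obs X := by
  have hb : ∀ i, ∀ j ∈ neighbors P obs X i, 0 ≤ P.barrier (objPos obs X j - X i) := fun i j hj =>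
    P.barrier_nonneg (hX.h_pos hj) (mem_neighbors.1 hj).2
  have hw : ∀ j : Fin N ⊕ κ, 0 ≤ pairWeight j := fun j => by linarith [half_le_pairWeight j]
  have hnn : ∀ i, ∀ j ∈ neighbors P obs X i,
      0 ≤ pairWeight j * P.barrier (objPos obs X j - X i) := fun i j hj =>
    mul_nonneg (hw j) (hb i j hj)
  have h1 := Finset.single_le_sum (hnn i) hj
  have h2 := Finset.single_le_sum (fun i _ => Finset.sum_nonneg (hnn i)) (Finset.mem_univ i)
  have h3 := mul_le_mul_of_nonneg_right (half_le_pairWeight j) (hb i j hj)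
  unfold potential
  linarith

/-- Each agent pair appears twice with weight `1/2`. Symmetry of sensing and oddness of the
derivative turn the terms in `V j` into a second copy of those in `V i`, while obstacles do not
move. -/
theorem CollisionFree.sum_fderiv_barrier (hX : CollisionFree P obs X) (V : Fin N → E n) :
    ∑ i, ∑ j ∈ neighbors P obs X i, pairWeight j *
        fderiv ℝ P.barrier (objPos obs X j - X i) (objPos (fun _ => 0) V j - V i) =
      ∑ i, ⟪gradPsi P obs X i, V i⟫_ℝ := by
  classical
  -- Extending by zero outside the neighbor sets gives sums over fixed index sets, whose order can
  -- be exchanged.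
  let A : Fin N → Fin N ⊕ κ → E n →L[ℝ] ℝ := fun i j =>
    if j ∈ neighbors P obs X i then fderiv ℝ P.barrier (objPos obs X j - X i) else 0
  have hA : ∀ i j : Fin N, A i (Sum.inl j) = -A j (Sum.inl i) := by
    intro i j
    simp only [A, inl_mem_neighbors_comm (i := i) (j := j)]
    split_ifs
    · simp only [objPos, Sum.elim_inl]
      rw [← P.fderiv_barrier_neg, neg_sub]
    · simp
  have sum_eq_sum_ite : ∀ i (f : Fin N ⊕ κ → ℝ), ∑ j ∈ neighbors P obs X i, f j =
      ∑ j, if j ∈ neighbors P obs X i then f j else 0 := by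
    intro i f
    simp
  have hL : ∀ i, ∑ j ∈ neighbors P obs X i, pairWeight j *
        fderiv ℝ P.barrier (objPos obs X j - X i) (objPos (fun _ => 0) V j - V i) =
      ∑ j : Fin N, (1 / 2) * A i (Sum.inl j) (V j) - ∑ j : Fin N, (1 / 2) * A i (Sum.inl j) (V i)
        - ∑ k : κ, A i (Sum.inr k) (V i) := by
    intro i
    have : ∀ j, (if j ∈ neighbors P obs X i then pairWeight j *
        fderiv ℝ P.barrier (objPos obs X j - X i) (objPos (fun _ => 0) V j - V i) else 0) =
        pairWeight j * A i j (objPos (fun _ => 0) V j - V i) := by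
      intro j
      simp only [A]
      split_ifs <;> simp
    rw [sum_eq_sum_ite i, Finset.sum_congr rfl fun j _ => this j,
      Fintype.sum_sum_type]
    simp [pairWeight, objPos, mul_add, Finset.sum_add_distrib, sub_eq_add_neg]
  have hR : ∀ i, ⟪gradPsi P obs X i, V i⟫_ℝ =
      -(∑ j : Fin N, A i (Sum.inl j) (V i)) - ∑ k : κ, A i (Sum.inr k) (V i) := by
    intro i
    have : ∀ j, (if j ∈ neighbors P obs X i then
        fderiv ℝ P.barrier (objPos obs X j - X i) (V i) else 0) = A i j (V i) := by
      intro j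
      simp only [A]
      split_ifs <;> simp
    rw [hX.inner_gradPsi, sum_eq_sum_ite i,
      Finset.sum_congr rfl fun j _ => this j, Fintype.sum_sum_type, neg_add, sub_eq_add_neg]
  simp only [hL, hR, Finset.sum_sub_distrib, Finset.sum_neg_distrib]
  have hswap : ∑ i, ∑ j, (1 / 2) * A i (Sum.inl j) (V j) =
      -∑ i, ∑ j, (1 / 2) * A i (Sum.inl j) (V i) := by
    rw [Finset.sum_comm, ← Finset.sum_neg_distrib]
    refine Finset.sum_congr rfl fun j _ => ?_
    rw [← Finset.sum_neg_distrib]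
    refine Finset.sum_congr rfl fun i _ => ?_
    rw [hA i j]
    simp
  rw [hswap]
  simp only [← Finset.mul_sum]
  ring

theorem CollisionFree.hasDerivAt_potential {p : ℝ → Fin N → E n} {V : Fin N → E n} {t : ℝ}
    (hX : CollisionFree P obs (p t))
    (hS : ∀ i, ∀ᶠ s in 𝓝 t, neighbors P obs (p s) i = neighbors P obs (p t) i)
    (hp : ∀ i, HasDerivAt (fun s => p s i) (V i) t) :
    HasDerivAt (fun s => potential P obs (p s)) (∑ i, ⟪gradPsi P obs (p t) i, V i⟫_ℝ) t := by
  rw [← hX.sum_fderiv_barrier]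
  have hobj : ∀ j, HasDerivAt (fun s => objPos obs (p s) j) (objPos (fun _ => 0) V j) t := by
    intro j
    cases j with
    | inl j => exact hp j
    | inr k => exact hasDerivAt_const t (obs k)
  have hfix : HasDerivAt (fun s => ∑ i, ∑ j ∈ neighbors P obs (p t) i,
      pairWeight j * P.barrier (objPos obs (p s) j - p s i))
      (∑ i, ∑ j ∈ neighbors P obs (p t) i, pairWeight j *
        fderiv ℝ P.barrier (objPos obs (p t) j - p t i) (objPos (fun _ => 0) V j - V i)) t := by
    refine HasDerivAt.fun_sum fun i _ => HasDerivAt.fun_sum fun j hj => HasDerivAt.const_mul _ ?_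
    exact (P.differentiableAt_barrier (hX.h_pos hj)).hasFDerivAt.comp_hasDerivAt t
      ((hobj j).sub (hp i))
  refine hfix.congr_of_eventuallyEq ?_
  filter_upwards [eventually_all.2 hS] with s hs
  simp only [potential, hs]

end Configurations

/-! ### The kinetic energy of the velocity error -/

section Kinetic

variable {n : ℕ}

theorem inner_apply_self_of_mem_skewAdjoint {A : E n →L[ℝ] E n}
    (hA : A ∈ skewAdjoint (E n →L[ℝ] E n)) (x : E n) : ⟪x, A x⟫_ℝ = 0 := by
  have h1 : ContinuousLinearMap.adjoint A = -A := skewAdjoint.mem_iff.1 hA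
  have h2 := ContinuousLinearMap.adjoint_inner_left A x x
  rw [h1, neg_apply, inner_neg_left, real_inner_comm] at h2
  linarith

/-- Skew-symmetry of `M' - 2C` replaces `½ eᵀM'e` by `eᵀCe`. -/
theorem LagrangianAgent.hasDerivAt_kinetic (L : LagrangianAgent n) {q e : ℝ → E n} {q' e' : E n}
    {t : ℝ} (hq : HasDerivAt q q' t) (he : HasDerivAt e e' t) :
    HasDerivAt (fun s => (1 / 2) * ⟪e s, L.M (q s) (e s)⟫_ℝ)
      (⟪e t, L.M (q t) e'⟫_ℝ + ⟪e t, L.C (q t) q' (e t)⟫_ℝ) t := by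
  have hM : HasDerivAt (fun s => L.M (q s)) (fderiv ℝ L.M (q t) q') t :=
    (L.differentiable_M (q t)).hasFDerivAt.comp_hasDerivAt t hq
  have h1 := (he.inner ℝ (hM.clm_apply he)).const_mul (1 / 2)
  refine h1.congr_deriv ?_
  have hsym : ⟪e', L.M (q t) (e t)⟫_ℝ = ⟪e t, L.M (q t) e'⟫_ℝ := by
    have := (L.posDef_M (q t)).1.isSymmetric e' (e t)
    rw [real_inner_comm]
    rw [real_inner_comm] at this
    simpa [real_inner_comm] using this.symm
  have hskew := inner_apply_self_of_mem_skewAdjoint (L.skew (q t) q') (e t)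
  simp only [sub_apply, smul_apply, inner_sub_right,
    real_inner_smul_right] at hskew
  rw [inner_add_right, hsym]
  linarith

end Kinetic

theorem IsPosDef.inner_nonneg {n : ℕ} {A : E n →L[ℝ] E n} (hA : IsPosDef A) (x : E n) :
    0 ≤ ⟪x, A x⟫_ℝ := by
  by_cases hx : x = 0
  · simp [hx]
  · exact (hA.2 x hx).le

/-! ### Safety of the filtered motions -/

section Safety

variable {n N : ℕ} {κ : Type*} [Fintype κ]

/-- The total energy: `k_p` times the potential energy plus the kinetic energy of the velocity
errors. -/
def energy (P : SafetyParams n) (obs : κ → E n) (L : Fin N → LagrangianAgent n) (α : ℝ → ℝ)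
    (kp : ℝ) (X V : Fin N → E n) : ℝ :=
  kp * potential P obs X +
    ∑ i, (1 / 2) * ⟪velErr P obs α X V i, (L i).M (X i) (velErr P obs α X V i)⟫_ℝ

variable {P : SafetyParams n} {obs : κ → E n} {L : Fin N → LagrangianAgent n} {α : ℝ → ℝ}
  {a kp kv T : ℝ} {Z : Set ℝ} {u p v : ℝ → Fin N → E n}

theorem IsMotion.exists_hasDerivAt_energy_le (hm : IsMotion P obs L α T Z u p v) (ha : 1 ≤ a)
    (hα : IsClassK a α) (hkp : 0 < kp) (hkv : 0 < kv) {t : ℝ} (ht : t ∈ Ioo 0 T \ Z)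
    (hX : CollisionFree P obs (p t))
    (hu : ∀ i, u t i ∈ feasible
      (tauBar P obs L α kp kv (p t) (v t) i (deriv (fun s => safeVel P obs α (p s) i) t))
      (velErr P obs α (p t) (v t) i)) :
    ∃ d ≤ kp * (N * α 1), HasDerivAt (fun s => energy P obs L α kp (p s) (v s)) d t := by
  have hpot := hX.hasDerivAt_potential (hm.neighbors_const t ht hX) (hm.kinematics t ht hX)
  choose acc hacc hdyn using hm.dynamics t ht hX
  have hkin := fun i => (L i).hasDerivAt_kinetic (hm.kinematics t ht hX i)
    ((hacc i).sub (hm.safeVel_diff t ht hX i).hasDerivAt)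
  refine ⟨_, ?_, (hpot.const_mul kp).add (HasDerivAt.fun_sum fun i _ => hkin i)⟩
  rw [Finset.mul_sum, ← Finset.sum_add_distrib]
  have hN : kp * (N * α 1) = ∑ _i : Fin N, kp * α 1 := by
    simp
    ring
  rw [hN]
  refine Finset.sum_le_sum fun i _ => ?_
  have hfeas : ⟪u t i - _, velErr P obs α (p t) (v t) i⟫_ℝ ≤ 0 := hu i
  have hsafe := hX.inner_gradPsi_safeVel_le ha hα i
  have hMe := (L i).posDef_M (p t i) |>.inner_nonneg (velErr P obs α (p t) (v t) i)
  rw [← hdyn i, tauBar, real_inner_comm] at hfeas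
  simp only [Pi.sub_apply]
  change kp * _ + (⟪velErr P obs α (p t) (v t) i, _⟫_ℝ +
    ⟪velErr P obs α (p t) (v t) i, (L i).C _ _ (velErr P obs α (p t) (v t) i)⟫_ℝ) ≤ _
  -- In the splitting `v = e_v + v_s`, the `e_v` part cancels against `-k_p ∇ψ` in `τ̄`; the `v_s`
  -- part is at most `α 1`.
  have hv : ⟪gradPsi P obs (p t) i, v t i⟫_ℝ = ⟪velErr P obs α (p t) (v t) i, gradPsi P obs (p t) i⟫_ℝ
      + ⟪gradPsi P obs (p t) i, safeVel P obs α (p t) i⟫_ℝ := by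
    rw [real_inner_comm (gradPsi P obs (p t) i), ← inner_add_right, velErr, sub_add_cancel]
  have hC : (L i).C (p t i) (v t i) (velErr P obs α (p t) (v t) i) =
      (L i).C (p t i) (v t i) (v t i) - (L i).C (p t i) (v t i) (safeVel P obs α (p t) i) :=
    map_sub _ _ _
  rw [hv, hC, map_sub]
  simp only [inner_sub_right, inner_add_right, real_inner_smul_right] at hfeas ⊢
  nlinarith [mul_le_mul_of_nonneg_left hsafe hkp.le, mul_nonneg hkv.le hMe]

theorem CollisionFree.barrier_le_energy {X : Fin N → E n} (hX : CollisionFree P obs X)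
    (hkp : 0 < kp) (V : Fin N → E n) {i : Fin N} {j : Fin N ⊕ κ}
    (hj : j ∈ neighbors P obs X i) :
    kp * P.barrier (objPos obs X j - X i) ≤ 2 * energy P obs L α kp X V := by
  have h1 := mul_le_mul_of_nonneg_left (hX.barrier_le_potential hj) hkp.le
  have h2 : 0 ≤ ∑ i, (1 / 2) *
      ⟪velErr P obs α X V i, (L i).M (X i) (velErr P obs α X V i)⟫_ℝ :=
    Finset.sum_nonneg fun i _ =>
      mul_nonneg (by norm_num) (((L i).posDef_M (X i)).inner_nonneg _)
  unfold energy
  linarith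

theorem IsMotion.collisionFree_of_forall_lt (hm : IsMotion P obs L α T Z u p v) (ha : 1 ≤ a)
    (hα : IsClassK a α) (hkp : 0 < kp) (hkv : 0 < kv)
    (hu : ∀ t ∈ Ioo 0 T \ Z, CollisionFree P obs (p t) → ∀ i, u t i ∈ feasible
      (tauBar P obs L α kp kv (p t) (v t) i (deriv (fun s => safeVel P obs α (p s) i) t))
      (velErr P obs α (p t) (v t) i))
    {t : ℝ} (ht : t ∈ Ioo 0 T) (hfree : ∀ s ∈ Ico 0 t, CollisionFree P obs (p s)) :
    CollisionFree P obs (p t) := by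
  intro i j hji
  by_contra hneg
  rw [not_lt] at hneg
  have hpt : Tendsto p (𝓝[<] t) (𝓝 (p t)) :=
    ((hm.continuousOn_p.continuousAt (Ico_mem_nhds ht.1 ht.2)).tendsto).mono_left
      nhdsWithin_le_nhds
  have hz : Tendsto (fun s => objPos obs (p s) j - p s i) (𝓝[<] t)
      (𝓝 (objPos obs (p t) j - p t i)) :=
    (((continuous_objPos obs j).sub (continuous_apply i)).tendsto (p t)).comp hpt
  -- a left neighborhood of `t` without exceptional times
  have hreg : ∀ᶠ s in 𝓝[<] t, s ∉ Z := by
    have hfin := (hm.locallyFinite t ht.2).subset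
      (inter_subset_inter_right Z (Ico_subset_Icc_self : Ico 0 t ⊆ Icc 0 t))
    have h1 : ∀ᶠ s in 𝓝 t, s ∉ Z ∩ Ico 0 t :=
      hfin.isClosed.isOpen_compl.mem_nhds fun h => lt_irrefl t h.2.2
    filter_upwards [nhdsWithin_le_nhds h1, Ioo_mem_nhdsLT ht.1] with s hs hs' hsZ
    exact hs ⟨hsZ, hs'.1.le, hs'.2⟩
  obtain ⟨s₀, hs₀, hs₀Z⟩ := (mem_nhdsLT_iff_exists_Ioo_subset' ht.1).1
    (hreg.and (Ioo_mem_nhdsLT ht.1))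
  -- Starting strictly inside the regular interval makes `W` differentiable at `s₁` as well.
  obtain ⟨s₁, hs₁⟩ := exists_between (show s₀ < t from hs₀)
  have hgood : ∀ s ∈ Ico s₁ t, s ∈ Ioo 0 T \ Z ∧ CollisionFree P obs (p s) := by
    intro s hs
    have h1 := hs₀Z (show s ∈ Ioo s₀ t from ⟨hs₁.1.trans_le hs.1, hs.2⟩)
    exact ⟨⟨⟨h1.2.1, hs.2.trans ht.2⟩, h1.1⟩, hfree s ⟨h1.2.1.le, hs.2⟩⟩
  choose! d hd using fun s hs =>
    hm.exists_hasDerivAt_energy_le ha hα hkp hkv (hgood s hs).1 (hgood s hs).2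
      (hu s (hgood s hs).1 (hgood s hs).2)
  set c := kp * (N * α 1)
  set W : ℝ → ℝ := fun s => energy P obs L α kp (p s) (v s)
  have hbound : ∀ s ∈ Ico s₁ t, W s ≤ W s₁ + c * (s - s₁) := by
    intro s hs
    have := Convex.image_sub_le_mul_sub_of_deriv_le (convex_Ico s₁ t) (f := W) (C := c)
      (fun x hx => (hd x hx).2.continuousAt.continuousWithinAt)
      (fun x hx => (hd x (interior_subset hx)).2.differentiableAt.differentiableWithinAt)
      (fun x hx => by
        rw [(hd x (interior_subset hx)).2.deriv]
        exact (hd x (interior_subset hx)).1)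
      s₁ ⟨le_rfl, hs₁.2⟩ s hs hs.1
    linarith
  set B := 2 * (W s₁ + |c| * (t - s₁)) / kp
  -- the pairwise safety function stays bounded below
  have hlow : ∀ᶠ s in 𝓝[<] t, Real.exp (-B) ≤ P.h (objPos obs (p s) j - p s i) := by
    -- Since `h ≤ 0` at time `t`, the pair is strictly inside the sensing radius there, so shortly
    -- before `t` its barrier is counted in the energy.
    have hnear : ∀ᶠ s in 𝓝[<] t, ‖objPos obs (p s) j - p s i‖ < P.rsen :=
      hz.norm.eventually (gt_mem_nhds (P.norm_lt_of_h_nonpos hneg))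
    filter_upwards [hnear, Ioo_mem_nhdsLT hs₁.2] with s hsn hs
    have hsI : s ∈ Ico s₁ t := ⟨hs.1.le, hs.2⟩
    have hX := (hgood s hsI).2
    have h1 := hX.barrier_le_energy (L := L) (α := α) hkp (v s)
      (mem_neighbors.2 ⟨hji, hsn.le⟩)
    have h2 := hbound s hsI
    have h3 : c * (s - s₁) ≤ |c| * (t - s₁) :=
      mul_le_mul (le_abs_self c) (by linarith [hs.2]) (by linarith [hs.1]) (abs_nonneg c)
    have h4 : P.barrier (objPos obs (p s) j - p s i) ≤ B := by
      rw [le_div_iff₀ hkp]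
      change _ ≤ 2 * W s at h1
      linarith
    rw [← Real.le_log_iff_exp_le (hX i j hji)]
    unfold SafetyParams.barrier at h4
    linarith
  have hlim := ge_of_tendsto ((P.continuous_h.tendsto _).comp hz) hlow
  linarith [Real.exp_pos (-B)]

theorem IsMotion.collisionFree (hm : IsMotion P obs L α T Z u p v) (ha : 1 ≤ a)
    (hα : IsClassK a α) (hkp : 0 < kp) (hkv : 0 < kv)
    (hu : ∀ t ∈ Ioo 0 T \ Z, CollisionFree P obs (p t) → ∀ i, u t i ∈ feasible
      (tauBar P obs L α kp kv (p t) (v t) i (deriv (fun s => safeVel P obs α (p s) i) t))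
      (velErr P obs α (p t) (v t) i))
    (h0 : CollisionFree P obs (p 0)) {t : ℝ} (ht : t ∈ Ico 0 T) :
    CollisionFree P obs (p t) := by
  by_contra hbad
  have hcl : IsClosed (Icc 0 t ∩ p ⁻¹' {X | CollisionFree P obs X}ᶜ) :=
    (hm.continuousOn_p.mono (Icc_subset_Ico_right ht.2)).preimage_isClosed_of_isClosed
      isClosed_Icc (isOpen_collisionFree P obs).isClosed_compl
  -- Collision is a closed condition, so a first collision time exists.
  obtain ⟨t₀, ⟨ht₀, ht₀bad⟩, hleast⟩ :=
    (isCompact_Icc.of_isClosed_subset hcl inter_subset_left).exists_isLeast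
      ⟨t, ⟨ht.1, le_rfl⟩, hbad⟩
  have hpos : 0 < t₀ := ht₀.1.lt_of_ne (by
    rintro rfl
    exact ht₀bad h0)
  refine ht₀bad (hm.collisionFree_of_forall_lt ha hα hkp hkv hu ⟨hpos, ht₀.2.trans_lt ht.2⟩ ?_)
  intro s hs
  by_contra hsbad
  exact not_lt.2 (hleast ⟨⟨hs.1, hs.2.le.trans ht₀.2⟩, hsbad⟩) hs.2

end Safety

end SafetyFilter

end

open SafetyFilter in
theorem mainTheorem1 {n N : ℕ} {κ : Type*} [Fintype κ]
    (P : SafetyParams n) (obs : κ → E n) (L : Fin N → LagrangianAgent n)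
    (a : ℝ) (ha : 1 ≤ a) (α : ℝ → ℝ) (hα : IsClassK a α)
    (hαN : ∀ s ∈ Set.Ioc (0 : ℝ) 1,
      α s ≤ ((N : ℝ) - 1) / (-Real.log s + ((N : ℝ) - 1)))
    (kp kv : ℝ) (hkp : 0 < kp) (hkv : 0 < kv)
    -- the learned policy: an arbitrary function of time and the positions and velocities
    (tauL : Fin N → ℝ → (Fin N → E n) → (Fin N → E n) → E n) :
    -- safety under every input that satisfies the constraint of the optimization problem
    (∀ (T : ℝ) (Z : Set ℝ) (u p v : ℝ → Fin N → E n),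
      IsMotion P obs L α T Z u p v →
      (∀ t ∈ Set.Ioo 0 T \ Z, CollisionFree P obs (p t) → ∀ i,
        u t i ∈ feasible
          (tauBar P obs L α kp kv (p t) (v t) i (deriv (fun s => safeVel P obs α (p s) i) t))
          (velErr P obs α (p t) (v t) i)) →
      CollisionFree P obs (p 0) →
      ∀ t ∈ Set.Ico 0 T, CollisionFree P obs (p t)) ∧
    -- safety under the filtered learned input
    (∀ (T : ℝ) (Z : Set ℝ) (u p v : ℝ → Fin N → E n),
      IsMotion P obs L α T Z u p v →
      (∀ t ∈ Set.Ioo 0 T \ Z, CollisionFree P obs (p t) → ∀ i,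
        u t i = filteredInput (tauL i t (p t) (v t))
          (tauBar P obs L α kp kv (p t) (v t) i (deriv (fun s => safeVel P obs α (p s) i) t))
          (velErr P obs α (p t) (v t) i)) →
      CollisionFree P obs (p 0) →
      ∀ t ∈ Set.Ico 0 T, CollisionFree P obs (p t)) ∧
    -- the optimization problem is always feasible, with the filtered input as unique solution
    (∀ (t : ℝ) (X V : Fin N → E n) (i : Fin N) (w : E n),
      let tl := tauL i t X V
      let tb := tauBar P obs L α kp kv X V i w
      let e := velErr P obs α X V i
      (feasible tb e).Nonempty ∧
      filteredInput tl tb e ∈ feasible tb e ∧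
      (∀ τ ∈ feasible tb e, ‖filteredInput tl tb e - tl‖ ^ 2 ≤ ‖τ - tl‖ ^ 2) ∧
      (∀ τ ∈ feasible tb e, (∀ σ ∈ feasible tb e, ‖τ - tl‖ ^ 2 ≤ ‖σ - tl‖ ^ 2) →
        τ = filteredInput tl tb e)) := by
  refine ⟨fun T Z u p v hm hu h0 t ht => hm.collisionFree ha hα hkp hkv hu h0 ht,
    fun T Z u p v hm hu h0 t ht => hm.collisionFree ha hα hkp hkv (fun t ht hX i => ?_) h0 ht,
    fun t X V i w => ?_⟩
  · rw [hu t ht hX i]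
    exact filteredInput_mem_feasible _ _ _
  · refine ⟨⟨_, filteredInput_mem_feasible (tauL i t X V) _ _⟩, filteredInput_mem_feasible _ _ _,
      fun τ hτ => ?_, fun τ hτ hmin => ?_⟩
    · have := norm_sq_filteredInput_add_le (tl := tauL i t X V) hτ
      linarith [sq_nonneg ‖τ - filteredInput (tauL i t X V)
        (tauBar P obs L α kp kv X V i w) (velErr P obs α X V i)‖]
    · have h1 := norm_sq_filteredInput_add_le (tl := tauL i t X V) hτ
      have h2 := hmin _ (filteredInput_mem_feasible (tauL i t X V) _ _)
      have h3 : ‖τ - filteredInput (tauL i t X V)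
        (tauBar P obs L α kp kv X V i w) (velErr P obs α X V i)‖ ^ 2 ≤ 0 := by linarith
      exact sub_eq_zero.1 (norm_eq_zero.1 (pow_eq_zero_iff two_ne_zero |>.1
        (le_antisymm h3 (sq_nonneg _))))
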